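/- For a nonzero algebraic number $\alpha\in\overline{\mathbb Q}^{\times}$ let $m(\alpha)=\deg\alpha\cdot h(\alpha)$ be its logarithmic Mahler measure, where $h$ is the absolute logarithmic Weil height, and for $t\in(0,\infty)$ let $$m_t(\alpha)=\inf\Big\{\Big(\sum_{n=1}^N m(\alpha_n)^t\Big)^{1/t} : N\in\mathbb N,\ \alpha_1,\dots,\alpha_N\in\overline{\mathbb Q}^{\times},\ \alpha=\prod_{n=1}^N\alpha_n\Big\}.$$ For a real sequence $\mathbf x=(x_1,x_2,\dots)$ with only finitely many nonzero entries write $\|\mathbf x\|_t=\big(\sum_n|x_n|^t\big)^{1/t}$. Fix $\alpha$. A set $K\subseteq(0,\infty)$ is called uniform if there is one such $\mathbf x$ with $m_t(\alpha)=\|\mathbf x\|_t$ for all $t\in K$. A point $t\in(0,\infty)$ is called standard if it lies in a uniform open interval $J\subseteq(0,\infty)$, and exceptional otherwise. Then for every $\alpha\in\overline{\mathbb Q}^{\times}$ there are only finitely many exceptional points in $(0,\infty)$. Moreover, $t\mapsto m_t(\alpha)$ is a piecewise function with finitely many pieces, each of which is the $L_t$ norm of a fixed real vector: there are $n\ge 0$,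 points $0=c_0<c_1<\dots<c_n<c_{n+1}=\infty$ and finitely supported real sequences $\mathbf x_0,\dots,\mathbf x_n$ such that $m_t(\alpha)=\|\mathbf x_i\|_t$ for all $0\le i\le n$ and all $t\in(0,\infty)$ with $c_i\le t\le c_{i+1}$. -/

import Mathlib

open Set

noncomputable section

namespace MetricMahler

/-- The logarithmic Mahler measure `m(α) = deg α · h(α)` of a nonzero algebraic number `α`, where
`h` is the absolute logarithmic Weil height (Mathlib's `NumberField.absLogHeight₁`: the logarithm
of the `1 / [ℚ(α) : ℚ]`-th power of the relative multiplicative height of `α` over `ℚ(α)`). -/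
def mahler (α : (AlgebraicClosure ℚ)ˣ) : ℝ :=
  ((minpoly ℚ (α : AlgebraicClosure ℚ)).natDegree : ℝ) *
    NumberField.absLogHeight₁ (α : AlgebraicClosure ℚ)

variable {G : Type*} [CommGroup G]

/-- The `t`-metric version `φ_t` of a height `φ : G → [0, ∞)`, for `0 < t < ∞`: the infimum of
`(∑ φ(a_n) ^ t) ^ (1 / t)` over all ways of writing `α` as a finite product `∏ a_n` in `G`. -/
def tMetric (φ : G → ℝ) (t : ℝ) (α : G) : ℝ :=
  sInf {r : ℝ | ∃ (N : ℕ) (a : Fin N → G), ∏ n, a n = α ∧ r = (∑ n, φ (a n) ^ t) ^ (1 / t)}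

/-- The `L_t` norm, `0 < t < ∞`, of a real sequence with finitely many nonzero entries. -/
def LtNorm (x : ℕ →₀ ℝ) (t : ℝ) : ℝ :=
  (∑ n ∈ x.support, |x n| ^ t) ^ (1 / t)

/-- A set `K` is uniform (for `φ` and `α`) if, for all `t ∈ K`, the value `φ_t(α)` is the
`L_t` norm of one vector that does not depend on `t`. -/
def IsUniform (φ : G → ℝ) (α : G) (K : Set ℝ) : Prop :=
  ∃ x : ℕ →₀ ℝ, ∀ t ∈ K, tMetric φ t α = LtNorm x t

/-- A point `t` of the open interval `I` is standard if it lies in a uniform open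
interval `J ⊆ I`. -/
def IsStandard (φ : G → ℝ) (α : G) (I : Set ℝ) (t : ℝ) : Prop :=
  ∃ J : Set ℝ, IsOpen J ∧ J.OrdConnected ∧ J ⊆ I ∧ t ∈ J ∧ IsUniform φ α J

/-- A point of `I` is exceptional if it is not standard. -/
def IsExceptional (φ : G → ℝ) (α : G) (I : Set ℝ) (t : ℝ) : Prop :=
  t ∈ I ∧ ¬ IsStandard φ α I t

end MetricMahler

end

/-! Let `K` be the normal closure of `ℚ(α)`. Given `α = ∏ aₙ`, replace each `aₙ` by a `dₙ`-th root
of its norm from `K(aₙ)` to `K`, where `dₙ = [K(aₙ) : K]`. Because `K` is normal, this does not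
increase the Mahler measure, and the new product differs from `α` only by a root of unity, of
measure zero (`exists_radical_factorization`). So only radicals of elements of `K` matter. For such
`β` the measure is `[K ∩ ℚ(β) : ℚ]` times the height of an element of `K`, so by Northcott it takes
finitely many values below any bound.

A factorization then counts only through the multiplicities of finitely many positive values. By
Dickson's lemma finitely many multiplicity vectors are minimal, so `m_t(α)^t` is a minimum of
finitely many exponential sums in `t`. Two distinct ones agree at finitely many points, and between
these points one sum stays minimal (`exists_piecewise_LtNorm`). -/

namespace NumberField
open Height Module

/-! ### Heights under extension of number fields -/

variable {K L : Type*} [Field K] [NumberField K] [Field L] [NumberField L]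

/-- For integral coordinates the finite places contribute the inverse norm of the ideal they
generate. Both the ideal norm and the product over embeddings become `[L : K]`-th powers in an
extension, so places above a given place need not be compared. -/
lemma mulHeight_integers_mul_absNorm {ι : Type*} [Finite ι] {x : ι → 𝓞 K} (hx : x ≠ 0) :
    mulHeight (fun i ↦ (x i : K)) * (Ideal.span (Set.range x)).absNorm =
      ∏ φ : K →+* ℂ, ⨆ i, ‖φ (x i)‖ := by
  have hx' : (fun i ↦ (x i : K)) ≠ 0 := by
    obtain ⟨i, hi⟩ := Function.ne_iff.mp hx
    exact Function.ne_iff.mpr ⟨i, by simpa using hi⟩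
  have h := absNorm_mul_finprod_finitePlace_eq_one hx
  classical
  rw [mulHeight_eq hx', mul_assoc, mul_comm (∏ᶠ _, _), h, mul_one]
  rw [← Finset.prod_fiberwise (s := Finset.univ) (g := InfinitePlace.mk)]
  refine Finset.prod_congr rfl fun v _ ↦ ?_
  rw [Finset.prod_congr rfl (g := fun _ ↦ ⨆ i, v (x i)), Finset.prod_const,
    InfinitePlace.card_filter_mk_eq]
  intro φ hφ
  simp only [Finset.mem_filter, Finset.mem_univ, true_and] at hφ
  subst hφ
  simp

lemma prod_embeddings_comp_algebraMap [Algebra K L] (f : (K →+* ℂ) → ℝ) :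
    ∏ φ : L →+* ℂ, f (φ.comp (algebraMap K L)) = (∏ φ : K →+* ℂ, f φ) ^ finrank K L := by
  classical
  rw [← Finset.prod_fiberwise (s := Finset.univ) (g := fun φ : L →+* ℂ ↦ φ.comp (algebraMap K L)),
    ← Finset.prod_pow]
  refine Finset.prod_congr rfl fun ψ _ ↦ ?_
  rw [Finset.prod_congr rfl (g := fun _ ↦ f ψ), Finset.prod_const]
  · congr 1
    let := ψ.toAlgebra
    rw [← AlgHom.card K L ℂ, ← Finset.card_univ]
    symm
    refine Finset.card_bij (fun φ _ ↦ φ.toRingHom) ?_ ?_ ?_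
    · intro φ _
      simp only [Finset.mem_filter, Finset.mem_univ, true_and]
      exact φ.comp_algebraMap
    · intro a _ b _ h
      ext x
      exact RingHom.congr_fun h x
    · intro φ hφ
      simp only [Finset.mem_filter, Finset.mem_univ, true_and] at hφ
      exact ⟨{ φ with commutes' := fun r ↦ RingHom.congr_fun hφ r }, by simp, rfl⟩
  · intro φ hφ
    simp only [Finset.mem_filter, Finset.mem_univ, true_and] at hφ
    rw [hφ]

theorem mulHeight₁_algebraMap [Algebra K L] (x : K) :
    mulHeight₁ (algebraMap K L x) = mulHeight₁ x ^ finrank K L := by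
  obtain ⟨a, b, hb, rfl⟩ := IsFractionRing.div_surjective (A := 𝓞 K) x
  have hb0 : b ≠ 0 := nonZeroDivisors.ne_zero hb
  have hab : ![a, b] ≠ 0 := fun h ↦ hb0 (by simpa using congr_fun h 1)
  let y : Fin 2 → 𝓞 L := fun i ↦ algebraMap (𝓞 K) (𝓞 L) (![a, b] i)
  have hy : y ≠ 0 := by
    intro h
    have := congr_fun h 1
    simp only [y, Pi.zero_apply] at this
    exact hb0 (by simpa using this)
  have h1 := mulHeight_integers_mul_absNorm hab
  have h2 := mulHeight_integers_mul_absNorm hy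
  have e1 : (fun i ↦ ((![a, b] i : 𝓞 K) : K)) = ![(a : K), (b : K)] := by
    ext i; fin_cases i <;> rfl
  have e2 : (fun i ↦ ((y i : 𝓞 L) : L)) = ![algebraMap K L a, algebraMap K L b] := by
    ext i; fin_cases i <;> rfl
  have e3 : Ideal.span (Set.range y) =
      (Ideal.span (Set.range ![a, b])).map (algebraMap (𝓞 K) (𝓞 L)) := by
    rw [Ideal.map_span, ← Set.range_comp]; rfl
  have e4 : ∏ φ : L →+* ℂ, ⨆ i, ‖φ (y i)‖ =
      (∏ φ : K →+* ℂ, ⨆ i, ‖φ ((![a, b] i : 𝓞 K) : K)‖) ^ finrank K L := by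
    rw [← prod_embeddings_comp_algebraMap]
    rfl
  have hpos : (0 : ℝ) < (Ideal.span (Set.range ![a, b])).absNorm := by
    rw [Nat.cast_pos, Nat.pos_iff_ne_zero, ne_eq, Ideal.absNorm_eq_zero_iff]
    intro h
    exact hb0 (by simpa using (Ideal.span_eq_bot.mp h) b ⟨1, rfl⟩)
  have e5 : finrank (𝓞 K) (𝓞 L) = finrank K L :=
    (IsFractionRing.finrank_eq (𝓞 K) K (𝓞 L) L).symm
  rw [e4, e3, Ideal.absNorm_algebraMap, e5, ← h1, e1, e2, mul_pow, Nat.cast_pow] at h2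
  rw [map_div₀, mulHeight₁_div_eq_mulHeight, mulHeight₁_div_eq_mulHeight]
  exact mul_right_cancel₀ (pow_pos hpos _).ne' h2

theorem logHeight₁_algebraMap [Algebra K L] (x : K) :
    logHeight₁ (algebraMap K L x) = finrank K L * logHeight₁ x := by
  rw [logHeight₁_eq_log_mulHeight₁, logHeight₁_eq_log_mulHeight₁, mulHeight₁_algebraMap,
    Real.log_pow]

open IntermediateField in
/-- The absolute height of an algebraic number can be computed in any number field. -/
theorem finrank_mul_absLogHeight₁_map {A : Type*} [Field A] [CharZero A] (f : L →+* A) (y : L) :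
    finrank ℚ L * absLogHeight₁ (f y) = logHeight₁ y := by
  have hy : IsIntegral ℚ (f y) :=
    (Algebra.IsIntegral.isIntegral (R := ℚ) y).map f.toRatAlgHom
  have : FiniteDimensional ℚ ℚ⟮f y⟯ := adjoin.finiteDimensional hy
  have : NumberField ℚ⟮f y⟯ := {}
  have hle : ℚ⟮f y⟯ ≤ f.toRatAlgHom.fieldRange := by
    rw [adjoin_simple_le_iff]; exact ⟨y, rfl⟩
  let g : ℚ⟮f y⟯ →ₐ[ℚ] L :=
    (AlgEquiv.ofInjectiveField f.toRatAlgHom).symm.toAlgHom.comp (IntermediateField.inclusion hle)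
  have hg : g (AdjoinSimple.gen ℚ (f y)) = y := by
    refine f.injective ?_
    have := congrArg Subtype.val ((AlgEquiv.ofInjectiveField f.toRatAlgHom).apply_symm_apply
      (IntermediateField.inclusion hle (AdjoinSimple.gen ℚ (f y))))
    exact this
  let := g.toRingHom.toAlgebra
  have h := logHeight₁_algebraMap (K := ℚ⟮f y⟯) (L := L) (AdjoinSimple.gen ℚ (f y))
  have hg' : algebraMap ℚ⟮f y⟯ L (AdjoinSimple.gen ℚ (f y)) = y := hg
  have hpos : (0 : ℝ) < finrank ℚ ℚ⟮f y⟯ := Nat.cast_pos.mpr finrank_pos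
  rw [hg'] at h
  rw [h, absLogHeight₁, absMulHeight₁, dif_pos hy, Real.log_rpow (mulHeight₁_pos _),
    ← finrank_mul_finrank ℚ ℚ⟮f y⟯ L, logHeight₁_eq_log_mulHeight₁]
  push_cast
  field_simp

end NumberField

/-! ### Zeros of exponential sums and piecewise minima -/

lemma Set.Finite.setOf_eq_zero_of_deriv {f f' : ℝ → ℝ} (hf : ∀ t, HasDerivAt f (f' t) t)
    (h : {t | f' t = 0}.Finite) : {t | f t = 0}.Finite := by
  classical
  set Z := h.toFinset
  -- By Rolle, this count of zeros of `f'` below `t` strictly increases from one zero of `f` to a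
  -- later one; being bounded, it leaves finitely many zeros.
  let r : ℝ → ℕ := fun t ↦ (Z.filter (· < t)).card
  refine Set.Finite.of_finite_image (f := r) ((Set.finite_Iic Z.card).subset ?_) ?_
  · rintro _ ⟨t, -, rfl⟩
    exact Finset.card_filter_le _ _
  · have key : ∀ a b, f a = 0 → f b = 0 → a < b → r a < r b := by
      intro a b ha hb hab
      obtain ⟨c, ⟨hac, hcb⟩, hc⟩ := exists_hasDerivAt_eq_zero hab
        (fun x _ ↦ (hf x).continuousAt.continuousWithinAt) (ha.trans hb.symm) (fun x _ ↦ hf x)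
      refine Finset.card_lt_card ⟨?_, ?_⟩
      · exact fun x hx ↦ by
          simp only [Finset.mem_filter] at hx ⊢
          exact ⟨hx.1, hx.2.trans hab⟩
      · intro hsub
        have : c ∈ Z.filter (· < a) :=
          hsub (Finset.mem_filter.mpr ⟨by simpa [Z] using hc, hcb⟩)
        exact absurd (Finset.mem_filter.mp this).2 hac.le.not_gt
    intro a ha b hb hab
    rcases lt_trichotomy a b with hlt | heq | hlt
    · exact absurd hab (key a b ha hb hlt).ne
    · exact heq
    · exact absurd hab (key b a hb ha hlt).ne'

/-- A nontrivial exponential sum has only finitely many real zeros. -/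
lemma finite_setOf_sum_mul_exp_eq_zero {ι : Type*} {l : ι → ℝ} (hl : l.Injective)
    (s : Finset ι) (b : ι → ℝ) (hb : ∃ i ∈ s, b i ≠ 0) :
    {t : ℝ | ∑ i ∈ s, b i * Real.exp (l i * t) = 0}.Finite := by
  classical
  induction s using Finset.induction_on generalizing b with
  | empty => simp at hb
  | insert j s hj ih =>
    by_cases hs : ∃ i ∈ s, b i ≠ 0
    · have hs' : ∃ i ∈ s, b i * (l i - l j) ≠ 0 := by
        obtain ⟨i, hi, hbi⟩ := hs
        refine ⟨i, hi, mul_ne_zero hbi (sub_ne_zero.mpr fun h ↦ hj ?_)⟩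
        exact hl h ▸ hi
      have hfin := ih _ hs'
      -- Multiplying by `exp (-(l j * t))` turns the `j`-th term into a constant, which
      -- differentiation removes.
      have hd : ∀ t, HasDerivAt (fun t ↦ b j + ∑ i ∈ s, b i * Real.exp ((l i - l j) * t))
          (∑ i ∈ s, b i * (Real.exp ((l i - l j) * t) * (l i - l j))) t := by
        intro t
        refine (HasDerivAt.fun_sum fun i _ ↦ HasDerivAt.const_mul _ ?_).const_add _
        simpa using ((hasDerivAt_id t).const_mul (l i - l j)).exp
      have e : ∀ i t, Real.exp ((l i - l j) * t) = Real.exp (-(l j * t)) * Real.exp (l i * t) := by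
        intro i t
        rw [← Real.exp_add]
        ring_nf
      refine (Set.Finite.setOf_eq_zero_of_deriv hd (hfin.subset fun t ht ↦ ?_)).subset
        fun t ht ↦ ?_
      · simp only [Set.mem_ofPred_eq] at ht ⊢
        have : ∑ i ∈ s, b i * (Real.exp ((l i - l j) * t) * (l i - l j)) =
            Real.exp (-(l j * t)) * ∑ i ∈ s, b i * (l i - l j) * Real.exp (l i * t) := by
          rw [Finset.mul_sum]
          refine Finset.sum_congr rfl fun i _ ↦ ?_
          rw [e]; ring
        rw [this] at ht
        exact (mul_eq_zero.mp ht).resolve_left (Real.exp_ne_zero _)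
      · simp only [Set.mem_ofPred_eq, Finset.sum_insert hj] at ht ⊢
        have : b j + ∑ i ∈ s, b i * Real.exp ((l i - l j) * t) =
            Real.exp (-(l j * t)) *
              (b j * Real.exp (l j * t) + ∑ i ∈ s, b i * Real.exp (l i * t)) := by
          rw [mul_add, Finset.mul_sum, mul_left_comm, ← Real.exp_add, neg_add_cancel,
            Real.exp_zero, mul_one]
          congr 1
          refine Finset.sum_congr rfl fun i _ ↦ ?_
          rw [e]; ring
        rw [this, ht, mul_zero]
    · push Not at hs
      have hbj : b j ≠ 0 := by
        obtain ⟨i, hi, hbi⟩ := hb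
        rcases Finset.mem_insert.mp hi with rfl | hi
        · exact hbi
        · exact absurd (hs i hi) hbi
      convert Set.finite_empty
      refine Set.eq_empty_of_forall_notMem fun t ht ↦ ?_
      simp only [Set.mem_ofPred_eq, Finset.sum_insert hj] at ht
      rw [Finset.sum_eq_zero fun i hi ↦ by rw [hs i hi, zero_mul], add_zero] at ht
      exact mul_ne_zero hbj (Real.exp_ne_zero _) ht

/-- The minimum of finitely many continuous functions on `(0, ∞)`, any two of which agree everywhere
or only at finitely many points, is attained piecewise, with finitely many pieces. -/
lemma exists_piecewise_minimizer {ι : Type*} [Finite ι] [Nonempty ι] (g : ι → ℝ → ℝ)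
    (hg : ∀ i, Continuous (g i))
    (hfin : ∀ i j, g i ≠ g j → {t | g i t = g j t}.Finite) :
    ∃ (n : ℕ) (c : Fin n → ℝ) (x : Fin (n + 1) → ι), StrictMono c ∧ (∀ j, 0 < c j) ∧
      ∀ (i : Fin (n + 1)) (t : ℝ), 0 < t →
        (∀ j : Fin n, j.castSucc < i → c j ≤ t) →
        (∀ j : Fin n, i ≤ j.castSucc → t ≤ c j) → ∀ k, g (x i) t ≤ g k t := by
  classical
  have hZ : (⋃ p : {p : ι × ι // g p.1 ≠ g p.2}, {t | g p.1.1 t = g p.1.2 t} ∩ Ioi 0).Finite :=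
    Set.finite_iUnion fun p ↦ (hfin _ _ p.2).inter_of_left _
  set Z := hZ.toFinset with hZdef
  have hmem : ∀ t, t ∈ Z ↔ 0 < t ∧ ∃ i j, g i ≠ g j ∧ g i t = g j t := by
    intro t
    simp only [hZdef, Set.Finite.mem_toFinset, Set.mem_iUnion, Set.mem_inter_iff, Set.mem_ofPred_eq,
      Set.mem_Ioi]
    constructor
    · rintro ⟨p, h1, h2⟩
      exact ⟨h2, _, _, p.2, h1⟩
    · rintro ⟨h2, i, j, h, h1⟩
      exact ⟨⟨(i, j), h⟩, h1, h2⟩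
  let c : Fin Z.card → ℝ := Z.orderEmbOfFin rfl
  have hc : StrictMono c := (Z.orderEmbOfFin rfl).strictMono
  have hcmem : ∀ j, c j ∈ Z := fun j ↦ Finset.orderEmbOfFin_mem Z rfl j
  have hc0 : ∀ j, 0 < c j := fun j ↦ ((hmem _).mp (hcmem j)).1
  have hcsurj : ∀ t ∈ Z, ∃ j, c j = t := by
    intro t ht
    have : t ∈ Set.range (Z.orderEmbOfFin rfl) := by
      rw [Finset.range_orderEmbOfFin]; exact ht
    exact this
  have hpt : ∀ i : Fin (Z.card + 1), ∃ s : ℝ, 0 < s ∧ (∀ j : Fin Z.card, j.castSucc < i → c j < s) ∧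
      (∀ j : Fin Z.card, i ≤ j.castSucc → s < c j) := by
    intro i
    obtain ⟨s, hl, hr⟩ := Order.exists_between_finsets
      (insert 0 ((Finset.univ.filter fun j : Fin Z.card ↦ j.castSucc < i).image c))
      ((Finset.univ.filter fun j : Fin Z.card ↦ i ≤ j.castSucc).image c) (by
        intro a ha b hb
        obtain ⟨j, hj, rfl⟩ := Finset.mem_image.mp hb
        rcases Finset.mem_insert.mp ha with rfl | ha
        · exact hc0 j
        · obtain ⟨k, hk, rfl⟩ := Finset.mem_image.mp ha
          exact hc (Fin.castSucc_lt_castSucc_iff.mp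
            ((Finset.mem_filter.mp hk).2.trans_le (Finset.mem_filter.mp hj).2)))
    exact ⟨s, hl _ (Finset.mem_insert_self _ _),
      fun j hj ↦ hl _ (Finset.mem_insert_of_mem (Finset.mem_image_of_mem _ (by simpa using hj))),
      fun j hj ↦ hr _ (Finset.mem_image_of_mem _ (by simpa using hj))⟩
  choose s hs0 hsl hsr using hpt
  -- The minimizer at an interior sample point of a piece serves the whole closed piece: if another
  -- function were smaller at `t`, the two would cross strictly before `t`, at a cut point inside
  -- the piece.
  choose x hx using fun i ↦ Finite.exists_min (fun k ↦ g k (s i))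
  refine ⟨Z.card, c, x, hc, hc0, fun i t ht htl htr k ↦ ?_⟩
  by_contra! hlt
  have hne : g (x i) ≠ g k := fun h ↦ hlt.ne (by rw [h])
  obtain ⟨u, hu, huv⟩ : ∃ u ∈ uIcc (s i) t, g (x i) u - g k u = 0 := by
    have hcont : Continuous fun u ↦ g (x i) u - g k u := (hg _).sub (hg _)
    obtain ⟨u, hu, hu'⟩ := intermediate_value_uIcc (hcont.continuousOn (s := uIcc (s i) t))
      (mem_uIcc.mpr (Or.inl ⟨sub_nonpos.mpr (hx i k), sub_nonneg.mpr hlt.le⟩))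
    exact ⟨u, hu, hu'⟩
  have huv' := sub_eq_zero.mp huv
  have hut : u ≠ t := fun h ↦ hlt.ne (by rw [← h, huv'])
  have hu0 : 0 < u := by
    rcases mem_uIcc.mp hu with h | h
    · exact (hs0 i).trans_le h.1
    · exact ht.trans_le h.1
  obtain ⟨j, rfl⟩ := hcsurj u ((hmem u).mpr ⟨hu0, _, _, hne, huv'⟩)
  rcases lt_or_ge j.castSucc i with hj | hj
  · rcases mem_uIcc.mp hu with h | h
    · exact absurd (hsl i j hj) h.1.not_gt
    · exact hut (le_antisymm (htl j hj) h.1)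
  · rcases mem_uIcc.mp hu with h | h
    · exact hut (le_antisymm h.2 (htr j hj))
    · exact absurd (hsr i j hj) h.2.not_gt

/-! ### Piecewise norms from finitely many values -/

namespace MetricMahler

lemma exists_LtNorm_eq {N : ℕ} (f : Fin N → ℝ) (hf : ∀ n, 0 ≤ f n) :
    ∃ x : ℕ →₀ ℝ, ∀ t, 0 < t → LtNorm x t = (∑ n, f n ^ t) ^ (1 / t) := by
  let e : ℕ → ℝ := fun i ↦ if h : i < N then f ⟨i, h⟩ else 0
  let x : ℕ →₀ ℝ := Finsupp.onFinset (Finset.range N) e fun i hi ↦ by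
    by_contra h
    exact hi (dif_neg (by simpa using h))
  refine ⟨x, fun t ht ↦ ?_⟩
  have h1 : ∑ n ∈ x.support, |x n| ^ t = ∑ n ∈ Finset.range N, |x n| ^ t := by
    refine Finset.sum_subset Finsupp.support_onFinset_subset fun i _ hi ↦ ?_
    rw [Finsupp.notMem_support_iff.mp hi, abs_zero, Real.zero_rpow ht.ne']
  have h2 : ∀ n : Fin N, x n = f n := fun n ↦ dif_pos n.2
  rw [LtNorm, h1, Finset.sum_range]
  simp only [h2, abs_of_nonneg (hf _)]

lemma finite_isExceptional_of_piecewise {G : Type*} [CommGroup G] {φ : G → ℝ} {α : G} {n : ℕ}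
    {c : Fin n → ℝ} {x : Fin (n + 1) → (ℕ →₀ ℝ)} (hc : StrictMono c)
    (h : ∀ (i : Fin (n + 1)) (t : ℝ), 0 < t →
      (∀ j : Fin n, j.castSucc < i → c j ≤ t) →
      (∀ j : Fin n, i ≤ j.castSucc → t ≤ c j) → tMetric φ t α = LtNorm (x i) t) :
    {t : ℝ | IsExceptional φ α (Ioi 0) t}.Finite := by
  refine (Set.finite_range c).subset fun t ht ↦ ?_
  by_contra hrange
  have hne : ∀ j, c j ≠ t := fun j hj ↦ hrange ⟨j, hj⟩
  -- The least index all of whose later cut points exceed `t`; minimality puts the earlier ones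
  -- below `t`.
  obtain ⟨i, hi, hmin⟩ := (wellFounded_lt (α := Fin (n + 1))).has_min
    {i | ∀ j : Fin n, i ≤ j.castSucc → t < c j}
    ⟨Fin.last n, fun j hj ↦ absurd (Fin.castSucc_lt_last j) hj.not_gt⟩
  have hlt : ∀ j : Fin n, j.castSucc < i → c j < t := by
    intro j hj
    by_contra! hle
    refine hmin j.castSucc (fun k hk ↦ ?_) hj
    exact (lt_of_le_of_ne hle (hne j).symm).trans_le
      (hc.monotone (Fin.castSucc_le_castSucc_iff.mp hk))
  let J : Set ℝ := Ioi 0 ∩ ⋂ j : Fin n, if j.castSucc < i then Ioi (c j) else Iio (c j)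
  refine ht.2 ⟨J, ?_, ?_, inter_subset_left, ⟨ht.1, ?_⟩, x i, ?_⟩
  · refine isOpen_Ioi.inter (isOpen_iInter_of_finite fun j ↦ ?_)
    split_ifs
    exacts [isOpen_Ioi, isOpen_Iio]
  · refine ordConnected_Ioi.inter (ordConnected_iInter fun j ↦ ?_)
    split_ifs
    exacts [ordConnected_Ioi, ordConnected_Iio]
  · refine mem_iInter.mpr fun j ↦ ?_
    split_ifs with hj
    exacts [hlt j hj, hi j (not_lt.mp hj)]
  · intro s hs
    refine h i s hs.1 (fun j hj ↦ ?_) fun j hj ↦ ?_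
    · have := mem_iInter.mp hs.2 j
      rw [if_pos hj] at this
      exact this.le
    · have := mem_iInter.mp hs.2 j
      rw [if_neg hj.not_gt] at this
      exact this.le

/-- If the infimum defining `φ_t(α)` can be taken over a set on which `φ` takes only finitely many
values below any bound, then `t ↦ φ_t(α)` is piecewise an `L_t` norm, with finitely many pieces. -/
theorem exists_piecewise_LtNorm {G : Type*} [CommGroup G] {φ : G → ℝ} (hφ : ∀ a, 0 ≤ φ a) {α : G}
    {R : Set G} (hα : α ∈ R) (hfin : ∀ B, (φ '' R ∩ Iic B).Finite)
    (hR : ∀ (N : ℕ) (a : Fin N → G), ∏ n, a n = α → ∃ (N' : ℕ) (b : Fin N' → G),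
      (∀ n, b n ∈ R) ∧ ∏ n, b n = α ∧ ∀ t : ℝ, 0 < t → ∑ n, φ (b n) ^ t ≤ ∑ n, φ (a n) ^ t) :
    ∃ (n : ℕ) (c : Fin n → ℝ) (x : Fin (n + 1) → (ℕ →₀ ℝ)),
      StrictMono c ∧ (∀ j, 0 < c j) ∧
      ∀ (i : Fin (n + 1)) (t : ℝ), 0 < t →
        (∀ j : Fin n, j.castSucc < i → c j ≤ t) →
        (∀ j : Fin n, i ≤ j.castSucc → t ≤ c j) → tMetric φ t α = LtNorm (x i) t := by
  classical
  have hWfin : ((φ '' R ∩ Iic (φ α)) ∩ Ioi 0).Finite := (hfin _).inter_of_left _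
  set W := hWfin.toFinset with hW
  have hWpos : ∀ w : W, (0 : ℝ) < w := fun w ↦ ((Set.Finite.mem_toFinset _).mp w.2).2
  -- Only positive values are counted: factors with `φ = 0` contribute `0 ^ t = 0`.
  let count : (N : ℕ) → (Fin N → G) → W → ℕ := fun N b w ↦
    (Finset.univ.filter fun n ↦ φ (b n) = w).card
  let S : Set (W → ℕ) := {k | ∃ (N : ℕ) (b : Fin N → G),
    (∀ n, b n ∈ R ∧ φ (b n) ≤ φ α) ∧ ∏ n, b n = α ∧ count N b = k}
  let g : (W → ℕ) → ℝ → ℝ := fun k t ↦ ∑ w, (k w : ℝ) * Real.exp (Real.log w * t)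
  have hcount : ∀ (N : ℕ) (b : Fin N → G), (∀ n, b n ∈ R ∧ φ (b n) ≤ φ α) → ∀ t, 0 < t →
      ∑ n, φ (b n) ^ t = g (count N b) t := by
    intro N b hb t ht
    have h1 : ∀ n, φ (b n) ^ t = ∑ w : W, if φ (b n) = w then (w : ℝ) ^ t else 0 := by
      intro n
      rcases (hφ (b n)).eq_or_lt with h0 | hpos
      · rw [← h0, Real.zero_rpow ht.ne']
        refine (Finset.sum_eq_zero fun w _ ↦ if_neg (hWpos w).ne).symm
      · have hmem : φ (b n) ∈ W :=
          (Set.Finite.mem_toFinset _).mpr ⟨⟨⟨_, (hb n).1, rfl⟩, (hb n).2⟩, hpos⟩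
        rw [Finset.sum_eq_single ⟨φ (b n), hmem⟩]
        · simp
        · exact fun w _ hw ↦ if_neg fun h ↦ hw (Subtype.ext h.symm)
        · simp
    simp only [h1]
    rw [Finset.sum_comm]
    refine Finset.sum_congr rfl fun w _ ↦ ?_
    rw [← Finset.sum_filter, Finset.sum_const, nsmul_eq_mul, Real.rpow_def_of_pos (hWpos w)]
  have hgmono : ∀ k k' : W → ℕ, k ≤ k' → ∀ t, g k t ≤ g k' t := fun k k' hk t ↦
    Finset.sum_le_sum fun w _ ↦
      mul_le_mul_of_nonneg_right (Nat.cast_le.mpr (hk w)) (Real.exp_pos _).le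
  have hg0 : ∀ k t, 0 ≤ g k t := fun k t ↦
    Finset.sum_nonneg fun w _ ↦ mul_nonneg (Nat.cast_nonneg _) (Real.exp_pos _).le
  have hbelow : ∀ k ∈ S, ∃ k', Minimal (· ∈ S) k' ∧ k' ≤ k := fun k hk ↦ by
    obtain ⟨k', h1, h2⟩ := exists_minimal_le_of_wellFoundedLT (· ∈ S) k hk
    exact ⟨k', h2, h1⟩
  let ι := {k | Minimal (· ∈ S) k}
  -- Dickson's lemma: an antichain in `W → ℕ` is finite.
  have hιfin : Finite ι := WellQuasiOrderedLE.finite_of_isAntichain (setOfPred_minimal_antichain _)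
  have hα' : ∀ n : Fin 1, (fun _ ↦ α : Fin 1 → G) n ∈ R ∧ φ ((fun _ ↦ α : Fin 1 → G) n) ≤ φ α :=
    fun _ ↦ ⟨hα, le_rfl⟩
  have hαS : count 1 (fun _ ↦ α) ∈ S := ⟨1, fun _ ↦ α, hα', by simp, rfl⟩
  have hιne : Nonempty ι := by
    obtain ⟨k, hk, -⟩ := hbelow _ hαS
    exact ⟨⟨k, hk⟩⟩
  have hval : ∀ (k : ι) (t : ℝ), 0 < t → (∀ k' : ι, g k t ≤ g k' t) →
      tMetric φ t α = g k t ^ (1 / t) := by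
    intro k t ht hk
    have ht' : 0 ≤ 1 / t := (one_div_pos.mpr ht).le
    have hle : ∀ k' ∈ S, g k t ≤ g k' t := by
      intro k' hk'
      obtain ⟨m, hm, hmk⟩ := hbelow k' hk'
      exact (hk ⟨m, hm⟩).trans (hgmono _ _ hmk t)
    refine le_antisymm (csInf_le ?_ ?_) (le_csInf ?_ ?_)
    · refine ⟨0, ?_⟩
      rintro _ ⟨N, a, -, rfl⟩
      exact Real.rpow_nonneg (Finset.sum_nonneg fun n _ ↦ Real.rpow_nonneg (hφ _) _) _
    · obtain ⟨N, b, hb, hprod, hkb⟩ := k.2.1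
      exact ⟨N, b, hprod, by rw [hcount N b hb t ht, hkb]⟩
    · exact ⟨_, 1, fun _ ↦ α, by simp, rfl⟩
    · rintro _ ⟨N, a, ha, rfl⟩
      obtain ⟨N', b, hbR, hb, hba⟩ := hR N a ha
      refine Real.rpow_le_rpow (hg0 _ _) (le_trans ?_ (hba t ht)) ht'
      by_cases hall : ∀ n, φ (b n) ≤ φ α
      · have hb' := fun n ↦ And.intro (hbR n) (hall n)
        rw [hcount N' b hb' t ht]
        exact hle _ ⟨N', b, hb', hb, rfl⟩
      -- A factor with value above `φ α` already makes the sum at least that of the one-term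
      -- factorization `α = α`.
      · push Not at hall
        obtain ⟨n, hn⟩ := hall
        calc g k t ≤ g (count 1 fun _ ↦ α) t := hle _ hαS
          _ = φ α ^ t := by rw [← hcount 1 _ hα' t ht]; simp
          _ ≤ φ (b n) ^ t := Real.rpow_le_rpow (hφ _) hn.le ht.le
          _ ≤ ∑ n, φ (b n) ^ t := Finset.single_le_sum (f := fun n ↦ φ (b n) ^ t)
            (fun n _ ↦ Real.rpow_nonneg (hφ _) _) (Finset.mem_univ n)
  have hlog : Function.Injective fun w : W ↦ Real.log w := fun v w h ↦
    Subtype.ext (Real.log_injOn_pos (hWpos v) (hWpos w) h)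
  obtain ⟨n, c, x, hc, hc0, hx⟩ := exists_piecewise_minimizer (fun k : ι ↦ g k)
    (fun k ↦ by fun_prop) (fun k k' hkk' ↦ by
      refine (finite_setOf_sum_mul_exp_eq_zero hlog Finset.univ
        (fun w ↦ ((k : W → ℕ) w : ℝ) - ((k' : W → ℕ) w : ℝ)) ?_).subset fun t ht ↦ ?_
      · by_contra! h
        refine hkk' (congrArg g (funext fun w ↦ ?_))
        exact_mod_cast sub_eq_zero.mp (h w (Finset.mem_univ w))
      · simp only [Set.mem_ofPred_eq, sub_mul, Finset.sum_sub_distrib]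
        exact sub_eq_zero.mpr ht)
  have hvec : ∀ k : ι, ∃ y : ℕ →₀ ℝ, ∀ t, 0 < t → LtNorm y t = g k t ^ (1 / t) := by
    intro k
    obtain ⟨N, b, hb, -, hkb⟩ := k.2.1
    obtain ⟨y, hy⟩ := exists_LtNorm_eq (fun n ↦ φ (b n)) fun n ↦ hφ _
    exact ⟨y, fun t ht ↦ by rw [hy t ht, hcount N b hb t ht, hkb]⟩
  choose y hy using hvec
  exact ⟨n, c, fun i ↦ y (x i), hc, hc0, fun i t ht hl hr ↦ by
    rw [hy _ t ht, hval _ t ht (hx i t ht hl hr)]⟩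

end MetricMahler

/-! ### Degrees over a normal subfield -/

namespace IntermediateField
open Polynomial Module

variable {k A : Type*} [Field k] [Field A] [Algebra k A]

/-- An automorphism fixing `β` preserves `K` by normality, so it carries `minpoly K β` to a monic
irreducible polynomial with root `β`, that is, to itself. Galois theory then places the coefficients
in `k⟮β⟯`. -/
lemma coeff_minpoly_mem_adjoin_of_normal [IsGalois k A] (K : IntermediateField k A) [Normal k K]
    (β : A) (i : ℕ) : ((minpoly K β).coeff i : A) ∈ k⟮β⟯ := by
  rw [← InfiniteGalois.fixedField_fixingSubgroup k⟮β⟯]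
  rw [mem_fixedField_iff]
  intro σ hσ
  have hσβ : σ β = β := (mem_fixingSubgroup_iff _ σ).mp hσ β (mem_adjoin_simple_self k β)
  let τ : K ≃ₐ[k] K := σ.restrictNormal K
  have hτ : ∀ x : K, ((τ x : K) : A) = σ x := fun x ↦ AlgEquiv.restrictNormal_commutes σ K x
  have hint : IsIntegral K β := Algebra.IsIntegral.isIntegral β
  have hp : (minpoly K β).map (τ : K →+* K) = minpoly K β := by
    refine minpoly.eq_of_irreducible_of_monic ?_ ?_ ((minpoly.monic hint).map _)
    · exact (Irreducible.map (mapEquiv (τ : K ≃+* K)) (minpoly.irreducible hint))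
    · have h := congrArg (σ : A →+* A) (minpoly.aeval K β)
      rw [map_zero, aeval_def, hom_eval₂] at h
      rw [aeval_def, eval₂_map, ← h]
      exact congrArg₂ (fun f x ↦ eval₂ f x (minpoly K β)) (RingHom.ext hτ) hσβ.symm
  have := congrArg (fun q : K[X] ↦ ((q.coeff i : K) : A)) hp
  simp only [coeff_map] at this
  rw [← hτ]
  exact this

/-- The coefficients of `minpoly K β` lie in `F = K ⊓ k⟮β⟯`, so `β` has the same degree over `F` as
over `K`; the rest is the tower law. -/
lemma natDegree_minpoly_mul_finrank_inf [IsGalois k A] (K : IntermediateField k A) [Normal k K]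
    (β : A) :
    (minpoly K β).natDegree * finrank k (K ⊓ k⟮β⟯ : IntermediateField k A) =
      (minpoly k β).natDegree := by
  set F : IntermediateField k A := K ⊓ k⟮β⟯ with hF
  have hintK : IsIntegral K β := Algebra.IsIntegral.isIntegral β
  have hintF : IsIntegral F β := Algebra.IsIntegral.isIntegral β
  have hintk : IsIntegral k β := Algebra.IsIntegral.isIntegral β
  have hadj : (F⟮β⟯).restrictScalars k = k⟮β⟯ := by
    rw [restrictScalars_adjoin]
    refine le_antisymm (adjoin_le_iff.mpr ?_) (adjoin.mono _ _ _ subset_union_right)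
    refine union_subset (fun x hx ↦ ?_) (by simp)
    exact (show F ≤ k⟮β⟯ from inf_le_right) hx
  have hdeg : (minpoly F β).natDegree = (minpoly K β).natDegree := by
    apply le_antisymm
    · obtain ⟨q, hq, hqdeg, hqm⟩ := lifts_and_natDegree_eq_and_monic (f := algebraMap F A)
        (p := (minpoly K β).map (algebraMap K A))
        ((lifts_iff_coeff_lifts _).mpr fun n ↦ by
          rw [coeff_map]
          exact ⟨⟨_, ((minpoly K β).coeff n).2, coeff_minpoly_mem_adjoin_of_normal K β n⟩, rfl⟩)
        ((minpoly.monic hintK).map _)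
      rw [natDegree_map] at hqdeg
      rw [← hqdeg]
      refine natDegree_le_of_dvd (minpoly.dvd F β ?_) hqm.ne_zero
      rw [aeval_def, ← eval_map, hq, eval_map, ← aeval_def, minpoly.aeval]
    · let j : F →+* K := (inclusion (inf_le_left : F ≤ K)).toRingHom
      rw [← natDegree_map j]
      refine natDegree_le_of_dvd (minpoly.dvd K β ?_) ((minpoly.monic hintF).map j).ne_zero
      rw [aeval_def, eval₂_map]
      exact minpoly.aeval F β
  have : Module.Free F F⟮β⟯ := Module.Free.of_divisionRing F F⟮β⟯
  rw [← hdeg, ← adjoin.finrank hintF, ← adjoin.finrank hintk, mul_comm,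
    finrank_mul_finrank k F F⟮β⟯, ← hadj]
  rfl

end IntermediateField

lemma Polynomial.card_aroots_eq_natDegree {k A : Type*} [Field k] [Field A] [Algebra k A]
    [IsAlgClosed A] (p : Polynomial k) : (p.aroots A).card = p.natDegree := by
  rw [← natDegree_map (algebraMap k A)]
  exact (IsAlgClosed.splits (p.map (algebraMap k A))).natDegree_eq_card_roots.symm

/-! ### Absolute heights, relative norms and radicals -/

namespace NumberField
open Height Module IntermediateField Polynomial

variable {A : Type*} [Field A] [CharZero A]

lemma absLogHeight₁_nonneg (x : A) : 0 ≤ absLogHeight₁ x := by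
  rw [absLogHeight₁, absMulHeight₁]
  split_ifs
  · have : NumberField ℚ⟮x⟯ := { to_finiteDimensional := adjoin.finiteDimensional ‹_› }
    exact Real.log_nonneg (Real.one_le_rpow (one_le_mulHeight₁ _) (by positivity))
  · simp

lemma finrank_mul_absLogHeight₁ (E : IntermediateField ℚ A) [NumberField E] (y : E) :
    finrank ℚ E * absLogHeight₁ (y : A) = logHeight₁ y :=
  finrank_mul_absLogHeight₁_map (algebraMap E A) y

lemma finite_setOf_absLogHeight₁_le (K : IntermediateField ℚ A) [FiniteDimensional ℚ K] (B : ℝ) :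
    {x : A | x ∈ K ∧ absLogHeight₁ x ≤ B}.Finite := by
  have : NumberField K := {}
  refine ((finite_setOfPred_logHeight₁_le K (finrank ℚ K * B)).image ((↑) : K → A)).subset ?_
  rintro x ⟨hx, hxB⟩
  refine ⟨⟨x, hx⟩, ?_, rfl⟩
  rw [Set.mem_ofPred_eq, ← finrank_mul_absLogHeight₁]
  exact mul_le_mul_of_nonneg_left hxB (Nat.cast_nonneg _)

variable [Algebra.IsAlgebraic ℚ A]

lemma absLogHeight₁_mul_le (x y : A) :
    absLogHeight₁ (x * y) ≤ absLogHeight₁ x + absLogHeight₁ y := by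
  let E : IntermediateField ℚ A := adjoin ℚ {x, y}
  have : FiniteDimensional ℚ E := finiteDimensional_adjoin fun z _ ↦ Algebra.IsIntegral.isIntegral z
  have : NumberField E := {}
  let x' : E := ⟨x, subset_adjoin _ _ (by simp)⟩
  let y' : E := ⟨y, subset_adjoin _ _ (by simp)⟩
  have h := logHeight₁_mul_le x' y'
  simp only [← finrank_mul_absLogHeight₁, ← mul_add] at h
  exact le_of_mul_le_mul_left h (Nat.cast_pos.mpr finrank_pos)

lemma absLogHeight₁_pow (x : A) (n : ℕ) : absLogHeight₁ (x ^ n) = n * absLogHeight₁ x := by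
  have : FiniteDimensional ℚ ℚ⟮x⟯ := adjoin.finiteDimensional (Algebra.IsIntegral.isIntegral x)
  have : NumberField ℚ⟮x⟯ := {}
  have h := logHeight₁_pow (AdjoinSimple.gen ℚ x) n
  simp only [← finrank_mul_absLogHeight₁, mul_left_comm (n : ℝ)] at h
  exact mul_left_cancel₀ (Nat.cast_pos.mpr finrank_pos).ne' h

lemma absLogHeight₁_one : absLogHeight₁ (1 : A) = 0 := by
  have h := absLogHeight₁_pow (1 : A) 0
  simpa using h

lemma absLogHeight₁_multiset_prod_le (s : Multiset A) :
    absLogHeight₁ s.prod ≤ (s.map absLogHeight₁).sum := by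
  induction s using Multiset.induction_on with
  | empty => simp [absLogHeight₁_one]
  | cons a s ih =>
    rw [Multiset.prod_cons, Multiset.map_cons, Multiset.sum_cons]
    exact (absLogHeight₁_mul_le _ _).trans (add_le_add_right ih _)

lemma absLogHeight₁_map (σ : A →ₐ[ℚ] A) (x : A) : absLogHeight₁ (σ x) = absLogHeight₁ x := by
  have : FiniteDimensional ℚ ℚ⟮x⟯ := adjoin.finiteDimensional (Algebra.IsIntegral.isIntegral x)
  have : NumberField ℚ⟮x⟯ := {}
  have h := finrank_mul_absLogHeight₁_map (σ.toRingHom.comp (algebraMap ℚ⟮x⟯ A))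
    (AdjoinSimple.gen ℚ x)
  rw [← finrank_mul_absLogHeight₁] at h
  exact mul_left_cancel₀ (Nat.cast_pos.mpr finrank_pos).ne' h

/-- Taking a `d`-th root divides the height by `d` and multiplies the degree by at most `d`. -/
lemma natDegree_mul_absLogHeight₁_root_le {x y : A} {d : ℕ} (hd : d ≠ 0) (h : y ^ d = x) :
    (minpoly ℚ y).natDegree * absLogHeight₁ y ≤ (minpoly ℚ x).natDegree * absLogHeight₁ x := by
  have hint : IsIntegral ℚ x := Algebra.IsIntegral.isIntegral x
  have hdeg : (minpoly ℚ y).natDegree ≤ (minpoly ℚ x).natDegree * d := by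
    rw [← natDegree_expand]
    refine natDegree_le_of_dvd (minpoly.dvd ℚ y ?_)
      ((expand_ne_zero (Nat.pos_of_ne_zero hd)).mpr (minpoly.ne_zero hint))
    rw [expand_aeval, h, minpoly.aeval]
  rw [← h, absLogHeight₁_pow, h, ← mul_assoc]
  exact mul_le_mul_of_nonneg_right (by exact_mod_cast hdeg) (absLogHeight₁_nonneg y)

section Normal

lemma isGalois_rat_of_isAlgClosed [IsAlgClosed A] : IsGalois ℚ A where
  to_normal := normal_iff.mpr fun x ↦ ⟨Algebra.IsIntegral.isIntegral x, IsAlgClosed.splits _⟩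

variable [IsAlgClosed A] (K : IntermediateField ℚ A)

/-- The norm of `β` from `K(β)` to `K`, as an element of the ambient field. -/
noncomputable def relNorm (β : A) : A := ((minpoly K β).aroots A).prod

lemma relNorm_eq (β : A) : relNorm K β =
    (-1) ^ (minpoly K β).natDegree * ((minpoly K β).coeff 0 : A) := by
  have hm := (minpoly.monic (Algebra.IsIntegral.isIntegral (R := K) β)).map (algebraMap K A)
  have h := (IsAlgClosed.splits ((minpoly K β).map (algebraMap K A))).coeff_zero_eq_prod_roots_of_monic hm
  rw [natDegree_map, coeff_map] at h
  have h' : ((minpoly K β).coeff 0 : A) = (-1) ^ (minpoly K β).natDegree * relNorm K β := h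
  rw [h', ← mul_assoc, ← mul_pow]
  simp

lemma relNorm_ne_zero {β : A} (hβ : β ≠ 0) : relNorm K β ≠ 0 := by
  rw [relNorm_eq]
  refine mul_ne_zero (pow_ne_zero _ (neg_ne_zero.mpr one_ne_zero)) ?_
  have := minpoly.coeff_zero_ne_zero (Algebra.IsIntegral.isIntegral (R := K) β) hβ
  simpa using this

lemma relNorm_mem (β : A) : relNorm K β ∈ K := by
  rw [relNorm_eq]
  exact mul_mem (pow_mem (neg_mem (one_mem K)) _) ((minpoly K β).coeff 0).2

/-- The norm is a product of conjugates of `β`, which all have the same height. -/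
lemma absLogHeight₁_relNorm_le (β : A) :
    absLogHeight₁ (relNorm K β) ≤ (minpoly K β).natDegree * absLogHeight₁ β := by
  refine (absLogHeight₁_multiset_prod_le _).trans ?_
  have : ((minpoly K β).aroots A).map absLogHeight₁ =
      ((minpoly K β).aroots A).map (Function.const A (absLogHeight₁ β)) := by
    refine Multiset.map_congr rfl fun x hx ↦ ?_
    have : Normal K A := normal_iff.mpr fun x ↦
      ⟨Algebra.IsIntegral.isIntegral x, IsAlgClosed.splits _⟩
    have hconj : IsConjRoot K β x :=
      (isConjRoot_iff_mem_minpoly_aroots (Algebra.IsIntegral.isIntegral β)).mpr hx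
    obtain ⟨σ, hσ⟩ := hconj.exists_algEquiv
    rw [← hσ]
    exact (absLogHeight₁_map (σ.toAlgHom.restrictScalars ℚ) x).symm
  rw [this, Multiset.map_const, Multiset.sum_replicate,
    card_aroots_eq_natDegree, nsmul_eq_mul]

/-- All conjugates over `K` share the `r`-th power `β ^ r`, so there is no loss in the height of
their product. -/
lemma absLogHeight₁_relNorm_of_pow_mem {β : A} {r : ℕ} (hr : r ≠ 0) (h : β ^ r ∈ K) :
    absLogHeight₁ (relNorm K β) = (minpoly K β).natDegree * absLogHeight₁ β := by
  have hpow : relNorm K β ^ r = (β ^ r) ^ (minpoly K β).natDegree := by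
    rw [relNorm, ← Multiset.map_id' ((minpoly K β).aroots A), ← Multiset.prod_map_pow,
      ← card_aroots_eq_natDegree (A := A), ← Multiset.prod_replicate]
    congr 1
    rw [← Multiset.map_const']
    refine Multiset.map_congr rfl fun x hx ↦ ?_
    have hdvd : minpoly K β ∣ X ^ r - C ⟨β ^ r, h⟩ := minpoly.dvd K β (by
      simp)
    have hx0 := aeval_eq_zero_of_dvd_aeval_eq_zero hdvd (mem_aroots.mp hx).2
    simp only [map_sub, map_pow, aeval_X, aeval_C] at hx0
    exact sub_eq_zero.mp hx0
  have h1 := congrArg absLogHeight₁ hpow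
  rw [absLogHeight₁_pow, absLogHeight₁_pow, absLogHeight₁_pow, mul_left_comm] at h1
  exact mul_left_cancel₀ (Nat.cast_ne_zero.mpr hr) h1

/-- Take the norm to `K` from `E`, the field generated by all factors: `M = [E : K]`, `e n = [E :
K(a n)]`. -/
lemma pow_finrank_eq_prod_relNorm_pow {N : ℕ} (a : Fin N → A) (h : ∏ n, a n ∈ K) :
    ∃ (M : ℕ) (e : Fin N → ℕ), M ≠ 0 ∧ (∀ n, (minpoly K (a n)).natDegree * e n = M) ∧
      (∏ n, a n) ^ M = ∏ n, relNorm K (a n) ^ e n := by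
  let E : IntermediateField K A := adjoin K (Set.range a)
  have : FiniteDimensional K E := finiteDimensional_adjoin fun z _ ↦ Algebra.IsIntegral.isIntegral z
  let b : Fin N → E := fun n ↦ ⟨a n, subset_adjoin _ _ ⟨n, rfl⟩⟩
  have hmin : ∀ n, minpoly K (b n) = minpoly K (a n) := fun n ↦ minpoly_eq (b n)
  refine ⟨finrank K E, fun n ↦ finrank K⟮b n⟯ E, finrank_pos.ne', fun n ↦ ?_, ?_⟩
  · have : Module.Free K K⟮b n⟯ := Module.Free.of_divisionRing K K⟮b n⟯
    rw [← hmin, ← adjoin.finrank (Algebra.IsIntegral.isIntegral (b n)),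
      finrank_mul_finrank K K⟮b n⟯ E]
  · have h1 : ∏ n, b n = algebraMap K E ⟨∏ n, a n, h⟩ := by
      apply Subtype.ext
      have : ((∏ n, b n : E) : A) = ∏ n, a n := map_prod (algebraMap E A) b Finset.univ
      rw [this]; rfl
    have h2 := congrArg (algebraMap K A) (congrArg (Algebra.norm K) h1)
    rw [Algebra.norm_algebraMap, map_prod, map_prod, map_pow] at h2
    refine h2.symm.trans (Finset.prod_congr rfl fun n _ ↦ ?_)
    rw [Algebra.norm_eq_prod_roots (x := b n) A (IsAlgClosed.splits _), hmin]
    rfl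

variable [@Normal ℚ K _ _ K.algebra']

lemma natDegree_minpoly_relNorm_le (β : A) :
    (minpoly ℚ (relNorm K β)).natDegree ≤ finrank ℚ (K ⊓ ℚ⟮β⟯ : IntermediateField ℚ A) := by
  have hfin : FiniteDimensional ℚ ℚ⟮β⟯ :=
    adjoin.finiteDimensional (Algebra.IsIntegral.isIntegral β)
  have : IsGalois ℚ A := isGalois_rat_of_isAlgClosed
  have hmem : relNorm K β ∈ K ⊓ ℚ⟮β⟯ := by
    refine ⟨relNorm_mem K β, ?_⟩
    rw [relNorm_eq]
    exact mul_mem (pow_mem (neg_mem (one_mem _)) _) (coeff_minpoly_mem_adjoin_of_normal K β 0)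
  have := minpoly.natDegree_le (A := ℚ)
    (⟨relNorm K β, hmem⟩ : (K ⊓ ℚ⟮β⟯ : IntermediateField ℚ A))
  rwa [← minpoly.algebraMap_eq
    (algebraMap (K ⊓ ℚ⟮β⟯ : IntermediateField ℚ A) A).injective] at this

/-- The norm multiplies the height by at most `[K(β) : K]`, while its degree is at most `[K ∩ ℚ(β) :
ℚ]`; these two factors multiply to `deg β`. -/
lemma natDegree_mul_absLogHeight₁_relNorm_le (β : A) :
    (minpoly ℚ (relNorm K β)).natDegree * absLogHeight₁ (relNorm K β) ≤
      (minpoly ℚ β).natDegree * absLogHeight₁ β := by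
  have : IsGalois ℚ A := isGalois_rat_of_isAlgClosed
  calc _ ≤ (finrank ℚ (K ⊓ ℚ⟮β⟯ : IntermediateField ℚ A) : ℝ) *
        ((minpoly K β).natDegree * absLogHeight₁ β) :=
      mul_le_mul (Nat.cast_le.mpr (natDegree_minpoly_relNorm_le K β))
        (absLogHeight₁_relNorm_le K β) (absLogHeight₁_nonneg _) (Nat.cast_nonneg _)
    _ = _ := by
      rw [← natDegree_minpoly_mul_finrank_inf K β]
      push_cast
      ring

/-- On the radical closure of a normal number field the Mahler measure takes only finitely many
values below any bound. -/
lemma finite_setOf_natDegree_mul_absLogHeight₁_le [FiniteDimensional ℚ K] (B : ℝ) :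
    {m : ℝ | ∃ β : A, (∃ r : ℕ, r ≠ 0 ∧ β ^ r ∈ K) ∧
      m = (minpoly ℚ β).natDegree * absLogHeight₁ β ∧ m ≤ B}.Finite := by
  have : IsGalois ℚ A := isGalois_rat_of_isAlgClosed
  refine (Set.Finite.image2 (fun (e : ℕ) (γ : A) ↦ e * absLogHeight₁ γ)
    (Set.finite_Iic (finrank ℚ K)) (finite_setOf_absLogHeight₁_le K B)).subset ?_
  rintro _ ⟨β, ⟨r, hr, hβ⟩, rfl, hle⟩
  -- The first factor is at most `[K : ℚ]`; the second is the height of an element of `K`, bounded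
  -- by `B`, so Northcott applies.
  have hval : (minpoly ℚ β).natDegree * absLogHeight₁ β =
      finrank ℚ (K ⊓ ℚ⟮β⟯ : IntermediateField ℚ A) * absLogHeight₁ (relNorm K β) := by
    rw [absLogHeight₁_relNorm_of_pow_mem K hr hβ, ← natDegree_minpoly_mul_finrank_inf K β]
    push_cast
    ring
  refine ⟨_, ?_, relNorm K β, ⟨relNorm_mem K β, ?_⟩, hval.symm⟩
  · exact finrank_le_of_le_right inf_le_left
  · rw [hval] at hle
    refine le_trans ?_ hle
    exact le_mul_of_one_le_left (absLogHeight₁_nonneg _) (Nat.one_le_cast.mpr finrank_pos)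

end Normal

end NumberField

/-! ### Application to the Mahler measure -/

namespace MetricMahler
open NumberField IntermediateField

instance isAlgebraic_rat_algebraicClosure : Algebra.IsAlgebraic ℚ (AlgebraicClosure ℚ) := by
  convert! AlgebraicClosure.isAlgebraic ℚ

instance normal_rat_algebraicClosure : Normal ℚ (AlgebraicClosure ℚ) :=
  normal_iff.mpr fun x ↦ ⟨Algebra.IsIntegral.isIntegral x, IsAlgClosed.splits _⟩

lemma mahler_nonneg (β : (AlgebraicClosure ℚ)ˣ) : 0 ≤ mahler β :=
  mul_nonneg (Nat.cast_nonneg _) (absLogHeight₁_nonneg _)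

lemma mahler_eq_zero_of_pow_eq_one {ζ : (AlgebraicClosure ℚ)ˣ} {M : ℕ} (hM : M ≠ 0)
    (h : ζ ^ M = 1) : mahler ζ = 0 := by
  have h1 := absLogHeight₁_pow (ζ : AlgebraicClosure ℚ) M
  rw [← Units.val_pow_eq_pow_val, h, Units.val_one, absLogHeight₁_one] at h1
  rw [mahler, (mul_eq_zero.mp h1.symm).resolve_left (Nat.cast_ne_zero.mpr hM), mul_zero]

/-- Any factorization of an element of a normal field `K` can be replaced by one into radicals of
elements of `K`, without increasing Mahler measures. -/
lemma exists_radical_factorization (K : IntermediateField ℚ (AlgebraicClosure ℚ))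
    [@Normal ℚ K _ _ K.algebra'] {N : ℕ} (a : Fin N → (AlgebraicClosure ℚ)ˣ)
    (h : ((∏ n, a n : (AlgebraicClosure ℚ)ˣ) : AlgebraicClosure ℚ) ∈ K) :
    ∃ (N' : ℕ) (b : Fin N' → (AlgebraicClosure ℚ)ˣ),
      (∀ n, ∃ r : ℕ, r ≠ 0 ∧ (b n : AlgebraicClosure ℚ) ^ r ∈ K) ∧ ∏ n, b n = ∏ n, a n ∧
      ∀ t : ℝ, 0 < t → ∑ n, mahler (b n) ^ t ≤ ∑ n, mahler (a n) ^ t := by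
  have hprod : ((∏ n, a n : (AlgebraicClosure ℚ)ˣ) : AlgebraicClosure ℚ) =
      ∏ n, (a n : AlgebraicClosure ℚ) := map_prod (Units.coeHom _) a Finset.univ
  obtain ⟨M, e, hM, he, hpow⟩ := pow_finrank_eq_prod_relNorm_pow K
    (fun n ↦ (a n : AlgebraicClosure ℚ)) (hprod ▸ h)
  have hd : ∀ n, (minpoly K (a n : AlgebraicClosure ℚ)).natDegree ≠ 0 := fun n hn ↦
    hM (by rw [← he n, hn, zero_mul])
  choose y hy using fun n ↦ IsAlgClosed.exists_pow_nat_eq (relNorm K (a n : AlgebraicClosure ℚ))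
    (Nat.pos_of_ne_zero (hd n))
  have hy0 : ∀ n, y n ≠ 0 := fun n hn ↦
    relNorm_ne_zero K (a n).ne_zero (by rw [← hy n, hn, zero_pow (hd n)])
  let b : Fin N → (AlgebraicClosure ℚ)ˣ := fun n ↦ Units.mk0 (y n) (hy0 n)
  -- The norm relation makes this an `M`-th root of unity; as an extra factor it restores the
  -- product at no cost.
  let ζ := (∏ n, a n) / ∏ n, b n
  have hbM : (∏ n, b n) ^ M = (∏ n, a n) ^ M := by
    apply Units.ext
    rw [Units.val_pow_eq_pow_val, Units.val_pow_eq_pow_val, hprod, hpow,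
      show ((∏ n, b n : (AlgebraicClosure ℚ)ˣ) : AlgebraicClosure ℚ) = ∏ n, y n from
        map_prod (Units.coeHom _) b Finset.univ, ← Finset.prod_pow]
    refine Finset.prod_congr rfl fun n _ ↦ ?_
    rw [← hy n, ← pow_mul, he n]
  have hζ : ζ ^ M = 1 := by rw [div_pow, hbM, div_self']
  have hbm : ∀ n, mahler (b n) ≤ mahler (a n) := fun n ↦
    (natDegree_mul_absLogHeight₁_root_le (hd n) (hy n)).trans
      (natDegree_mul_absLogHeight₁_relNorm_le K _)
  refine ⟨N + 1, Fin.cons ζ b, fun n ↦ ?_, ?_, fun t ht ↦ ?_⟩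
  · induction n using Fin.cases with
    | zero =>
      refine ⟨M, hM, ?_⟩
      rw [Fin.cons_zero, ← Units.val_pow_eq_pow_val, hζ]
      exact one_mem K
    | succ n =>
      refine ⟨_, hd n, ?_⟩
      rw [Fin.cons_succ, Units.val_mk0, hy n]
      exact relNorm_mem K _
  · rw [Fin.prod_univ_succ]
    simp only [Fin.cons_zero, Fin.cons_succ]
    exact div_mul_cancel _ _
  · rw [Fin.sum_univ_succ]
    simp only [Fin.cons_zero, Fin.cons_succ]
    rw [mahler_eq_zero_of_pow_eq_one hM hζ, Real.zero_rpow ht.ne', zero_add]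
    exact Finset.sum_le_sum fun n _ ↦ Real.rpow_le_rpow (mahler_nonneg _) (hbm n) ht.le

theorem exists_piecewise_mahler (α : (AlgebraicClosure ℚ)ˣ) :
    ∃ (n : ℕ) (c : Fin n → ℝ) (x : Fin (n + 1) → (ℕ →₀ ℝ)),
      StrictMono c ∧ (∀ j, 0 < c j) ∧
      ∀ (i : Fin (n + 1)) (t : ℝ), 0 < t →
        (∀ j : Fin n, j.castSucc < i → c j ≤ t) →
        (∀ j : Fin n, i ≤ j.castSucc → t ≤ c j) → tMetric mahler t α = LtNorm (x i) t := by
  have : FiniteDimensional ℚ ℚ⟮(α : AlgebraicClosure ℚ)⟯ :=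
    adjoin.finiteDimensional (Algebra.IsIntegral.isIntegral _)
  -- Normality is needed for the degree identity, finiteness for Northcott.
  let K : IntermediateField ℚ (AlgebraicClosure ℚ) :=
    IntermediateField.normalClosure ℚ ℚ⟮(α : AlgebraicClosure ℚ)⟯ (AlgebraicClosure ℚ)
  have : FiniteDimensional ℚ K := normalClosure.is_finiteDimensional _ _ _
  have : @Normal ℚ K _ _ K.algebra' := normalClosure.normal _ _ _
  have hα : (α : AlgebraicClosure ℚ) ∈ K :=
    IntermediateField.le_normalClosure _ (mem_adjoin_simple_self ℚ _)
  refine exists_piecewise_LtNorm mahler_nonneg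
    (R := {β | ∃ r : ℕ, r ≠ 0 ∧ (β : AlgebraicClosure ℚ) ^ r ∈ K})
    ⟨1, one_ne_zero, by rwa [pow_one]⟩ (fun B ↦ ?_) fun N a ha ↦ ?_
  · refine (finite_setOf_natDegree_mul_absLogHeight₁_le K B).subset ?_
    rintro _ ⟨⟨β, hβ, rfl⟩, hB⟩
    exact ⟨β, hβ, rfl, hB⟩
  · obtain ⟨N', b, hb, hprod, hle⟩ := exists_radical_factorization K a (ha ▸ hα)
    exact ⟨N', b, hb, hprod.trans ha, hle⟩

end MetricMahler

/-- For every nonzero algebraic number `α` the function `t ↦ m_t(α)` has only finitely many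
exceptional points in `(0, ∞)`. Moreover there are finitely many breakpoints
`0 < c 0 < ⋯ < c (n - 1)` that cut `(0, ∞)` into `n + 1` pieces, the `i`-th piece running
from `c (i - 1)` (or `0`) to `c i` (or `∞`), such that on the `i`-th piece `m_t(α)` is the
`L_t` norm of a fixed real vector `x i`. -/
theorem corollary2p3 (α : (AlgebraicClosure ℚ)ˣ) :
    {t : ℝ | MetricMahler.IsExceptional MetricMahler.mahler α (Set.Ioi 0) t}.Finite ∧
    ∃ (n : ℕ) (c : Fin n → ℝ) (x : Fin (n + 1) → (ℕ →₀ ℝ)),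
      StrictMono c ∧ (∀ j, 0 < c j) ∧
      ∀ (i : Fin (n + 1)) (t : ℝ), 0 < t →
        (∀ j : Fin n, j.castSucc < i → c j ≤ t) →
        (∀ j : Fin n, i ≤ j.castSucc → t ≤ c j) →
        MetricMahler.tMetric MetricMahler.mahler t α = MetricMahler.LtNorm (x i) t := by
  obtain ⟨n, c, x, hc, hc0, h⟩ := MetricMahler.exists_piecewise_mahler α
  exact ⟨MetricMahler.finite_isExceptional_of_piecewise hc h, n, c, x, hc, hc0, h⟩
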